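/- Let $E=\{a,b,c,d,e,f,g,h\}$ be a set of eight elements and let $\mathcal L$ be the family of the eight three-element sets $$\{a,f,d\},\{e,b,h\},\{a,b,g\},\{e,f,c\},\{e,g,d\},\{a,c,h\},\{b,c,d\},\{f,g,h\}.$$ Then the family $$\mathcal B=\{B\subseteq E : |B|=3,\ |B\cap L|\le 2 \text{ for all } L\in\mathcal L\}$$ is the family of bases of a matroid $M$ on $E$ of rank $3$, and the flats of rank $2$ of $M$ with at least three elements are exactly the members of $\mathcal L$. The matroid $M$ is simple (it has no loops and no parallel elements), connected (it is not a direct sum of two matroids with non-empty ground sets) and not binary (not representable over the field $\mathbb F_2$). Moreover, $M$ is minimal in the weak-map order among the connected matroids on $E$: if $N$ is a connected matroid on $E$ and every base of $N$ is a base of $M$, then $N=M$. Thus $M$ is a rank-$3$ example of a matroid of type (b), that is, a non-binary connected matroid which is minimal, with respect to inclusion of base systems, among the connected matroids on its ground set. -/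

import Mathlib

open Set

universe u

/-- A matroid is connected if it is not the direct sum of two matroids whose (disjoint) ground
sets are both non-empty. -/
def Matroid.IsConnectedMatroid {α : Type u} (M : Matroid α) : Prop :=
  ¬ ∃ (M₁ M₂ : Matroid α) (h : Disjoint M₁.E M₂.E),
      M₁.E.Nonempty ∧ M₂.E.Nonempty ∧ M = M₁.disjointSum M₂ h

/-- A matroid is simple if it has neither loops nor parallel pairs, i.e. if every set of at most
two elements of the ground set is independent (`x = y` is allowed below). -/
def Matroid.IsSimpleMatroid {α : Type u} (M : Matroid α) : Prop :=
  ∀ x ∈ M.E, ∀ y ∈ M.E, M.Indep {x, y}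

/-- A matroid is binary if it is representable over the two-element field: its elements can be
mapped to vectors of a vector space over `𝔽₂` such that the independent sets are exactly the sets
which are mapped to linearly independent families. -/
def Matroid.IsBinary {α : Type u} (M : Matroid α) : Prop :=
  ∃ (W : Type u) (_ : AddCommGroup W) (_ : Module (ZMod 2) W) (v : α → W),
    ∀ I ⊆ M.E, M.Indep I ↔ LinearIndepOn (ZMod 2) v I

/-- The weak-map order `N ⪯ M`: the matroids have the same ground set, and every base of `N` is a
base of `M`. (Equality of the ranks follows, as a matroid has a base.) -/
def Matroid.WeakMapLE {α : Type u} (N M : Matroid α) : Prop :=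
  N.E = M.E ∧ {B | N.IsBase B} ⊆ {B | M.IsBase B}

/-- `M` is minimal, in the weak-map order, among the connected matroids on its ground set. -/
def Matroid.IsMinimalConnected {α : Type u} (M : Matroid α) : Prop :=
  M.IsConnectedMatroid ∧ ∀ N : Matroid α, N.IsConnectedMatroid → N.WeakMapLE M → N = M

/-- Type (b): non-binary, but minimal among the connected matroids. -/
def Matroid.IsTypeB {α : Type u} (M : Matroid α) : Prop :=
  ¬ M.IsBinary ∧ M.IsMinimalConnected

/-- The eight three-point lines on `{a, b, c, d, e, f, g, h}`, where the points
`a, b, c, d, e, f, g, h` are `0, 1, 2, 3, 4, 5, 6, 7`, in the order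
`afd, ebh, abg, efc, egd, ach, bcd, fgh`. -/
def eightLines : Finset (Finset (Fin 8)) :=
  {{0, 5, 3}, {4, 1, 7}, {0, 1, 6}, {4, 5, 2}, {4, 6, 3}, {0, 2, 7}, {1, 2, 3}, {5, 6, 7}}

/-! Two lines share at most one point; basis exchange for the non-lines follows. Over 𝔽₂ every line
would give a relation z = x + y, and four of these force e = f.

For minimality, let N be connected with all its bases among those of M. Then N has rank 3 and every
line is dependent in N; it remains to show that every non-line is independent in N. A connected
matroid has r(X) + r(E \ X) > r(E) for proper non-empty X (`eRk_add_eRk_compl_gt`). If two points of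
a line are independent in N, their closure contains the line, so closures grow along lines
(`lineSweep_subset_closure`). Growing from a parallel class with several points violates the
inequality (`indep_pair_of_connected`). Hence N is simple, and growing from a dependent non-line
would put all eight points in rank 2 (`indep_of_isNonline_of_connected`). The growth is a finite
computation on bit masks. -/

/-- The three-element sets that are not among the eight lines. -/
def IsNonline (S : Finset (Fin 8)) : Prop := S.card = 3 ∧ S ∉ eightLines

instance : DecidablePred IsNonline := fun S ↦
  inferInstanceAs (Decidable (S.card = 3 ∧ S ∉ eightLines))

/-- The eight lines as bit masks. -/
def lineMasks : List ℕ := [41, 146, 67, 52, 88, 133, 14, 224]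

/-- The eight points as bit masks. -/
def pointMasks : List ℕ := [1, 2, 4, 8, 16, 32, 64, 128]

/-- Add the line `ℓ` to the point set `U` if it contains a point of `U` in `P` and a point of `U`
outside `P`; all sets are given as bit masks. -/
def lineStep (P U ℓ : ℕ) : ℕ :=
  bif (ℓ &&& U &&& P).beq 0 || ((ℓ &&& U) ||| P).beq P then U else U ||| ℓ

/-- Apply `lineStep P` to the eight lines, for each mask `P` of the list in turn. -/
def lineSweep (Ps : List ℕ) (T : ℕ) : ℕ := Ps.foldl (fun U P ↦ lineMasks.foldl (lineStep P) U) T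

/-! ### Finite checks on the line configuration -/

theorem card_of_mem_eightLines : ∀ L ∈ eightLines, L.card = 3 := by decide +kernel

theorem card_inter_of_mem_eightLines :
    ∀ L ∈ eightLines, ∀ L' ∈ eightLines, 2 ≤ (L ∩ L').card → L = L' := by
  decide +kernel

theorem exists_isNonline_mem :
    ∀ x y : Fin 8, ∃ w z, IsNonline {x, w, z} ∧ y ∈ ({x, w, z} : Finset (Fin 8)) := by
  decide +kernel

theorem exists_common_isNonline :
    ∀ x y : Fin 8, ∃ w z, IsNonline {x, w, z} ∧ IsNonline {y, w, z} := by
  decide +kernel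

theorem exists_isNonline_subset_insert :
    ∀ L ∈ eightLines, ∀ w ∉ L, ∃ x ∈ L, IsNonline (insert w (L.erase x)) := by
  decide +kernel

theorem exists_line_of_mem_lineMasks :
    ∀ ℓ ∈ lineMasks, ℓ < 2 ^ 8 ∧ ∃ L ∈ eightLines, ∀ i : Fin 8, i ∈ L ↔ ℓ.testBit i := by
  decide +kernel

theorem lineSweep_points_eq :
    ∀ x y z : Fin 8, IsNonline {x, y, z} →
      lineSweep (pointMasks ++ pointMasks) (2 ^ x.val ||| 2 ^ y.val ||| 2 ^ z.val) = 255 := by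
  decide +kernel

/-- `P` stands for a parallel class with at least two points. Either alternative splits the ground
set into parts of ranks at most 1 and 2: `P` and a line, or `v` and the points generated by `P` and
`d`. -/
theorem exists_lineSweep_eq :
    ∀ P < 2 ^ 8, P ≠ 0 → (∀ i : Fin 8, P ≠ 2 ^ i.val) → 255 ^^^ P ∈ lineMasks ∨
      ∃ d v : Fin 8, lineSweep [P, P] (P ||| 2 ^ d.val) ||| 2 ^ v.val = 255 := by
  decide +kernel

theorem testBit_255 : ∀ i : Fin 8, (255).testBit i := by decide

/-- If every point of `S` outside `{u, v}` were on a line with `u` and `v`, these lines would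
coincide, and `S` would be that line. -/
theorem exists_extension_isNonline {u v : Fin 8} (huv : u ≠ v) {S : Finset (Fin 8)}
    (hS : IsNonline S) : ∃ y ∈ S, IsNonline {y, u, v} := by
  by_contra! hcon
  have hline {y : Fin 8} (hy : y ∈ S) (hyu : y ≠ u) (hyv : y ≠ v) : {y, u, v} ∈ eightLines := by
    by_contra h
    exact hcon y hy ⟨Finset.card_eq_three.2 ⟨y, u, v, hyu, hyv, huv, rfl⟩, h⟩
  obtain ⟨y, hy, hyuv⟩ : ∃ y ∈ S, y ∉ ({u, v} : Finset (Fin 8)) := by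
    refine Finset.exists_mem_notMem_of_card_lt_card ?_
    rw [hS.1, Finset.card_pair huv]
    norm_num
  simp only [Finset.mem_insert, Finset.mem_singleton, not_or] at hyuv
  have hL := hline hy hyuv.1 hyuv.2
  have hsub : S ⊆ {y, u, v} := by
    intro z hz
    by_contra hzL
    have hz' : z ≠ y ∧ z ≠ u ∧ z ≠ v := by simpa using hzL
    have heq := card_inter_of_mem_eightLines _ hL _ (hline hz hz'.2.1 hz'.2.2) (by
      rw [← Finset.card_pair huv]
      exact Finset.card_le_card (by simp [Finset.subset_iff]))
    exact hzL (heq ▸ Finset.mem_insert_self z _)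
  have := Finset.eq_of_subset_of_card_le hsub (by rw [hS.1, card_of_mem_eightLines _ hL])
  exact hS.2 (this ▸ hL)

/-! ### Connectedness in terms of rank -/

namespace Matroid

theorem eRk_add_eRk_compl_gt {α : Type*} {M : Matroid α} {X : Set α}
    (hM : M.IsConnectedMatroid) (hX : X ⊆ M.E) (hne : X.Nonempty) (hne' : (M.E \ X).Nonempty)
    (hfin : M.eRank ≠ ⊤) : M.eRank < M.eRk X + M.eRk (M.E \ X) := by
  by_contra! hle
  have hdisj : Disjoint (M ↾ X).E (M ↾ (M.E \ X)).E := by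
    rw [restrict_ground_eq, restrict_ground_eq]
    exact disjoint_sdiff_right
  refine hM ⟨M ↾ X, M ↾ (M.E \ X), hdisj, hne, hne', ?_⟩
  refine Matroid.ext_indep (by
    rw [disjointSum_ground_eq, restrict_ground_eq, restrict_ground_eq, union_sdiff_cancel hX])
    fun I hI ↦ ?_
  rw [disjointSum_indep_iff, restrict_ground_eq, restrict_ground_eq, restrict_indep_iff,
    restrict_indep_iff, union_sdiff_self]
  simp only [inter_subset_right, and_true]
  refine ⟨fun h ↦ ⟨h.inter_right _, h.inter_right _, hI.trans subset_union_right⟩,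
    fun ⟨h₁, h₂, _⟩ ↦ ?_⟩
  obtain ⟨J₁, hJ₁, hIJ₁⟩ := h₁.subset_isBasis_of_subset inter_subset_right hX
  obtain ⟨J₂, hJ₂, hIJ₂⟩ := h₂.subset_isBasis_of_subset inter_subset_right sdiff_subset
  have hrk : M.eRk (J₁ ∪ J₂) = M.eRank := by
    rw [hJ₁.eRk_eq_eRk_union, union_comm, hJ₂.eRk_eq_eRk_union, sdiff_union_of_subset hX,
      eRk_ground]
  -- The union of the two bases spans and has at most r(M) elements.
  have hJ : M.Indep (J₁ ∪ J₂) := by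
    refine IsRkFinite.indep_of_encard_le_eRk ?_ ?_
    · rw [← eRk_ne_top_iff, hrk]; exact hfin
    · rw [hrk]
      refine (encard_union_le _ _).trans (le_trans ?_ hle)
      rw [hJ₁.encard_eq_eRk, hJ₂.encard_eq_eRk]
  refine hJ.subset fun x hx ↦ ?_
  by_cases hxX : x ∈ X
  · exact Or.inl (hIJ₁ ⟨hx, hxX⟩)
  · exact Or.inr (hIJ₂ ⟨hx, hI hx, hxX⟩)

theorem mem_closure_pair_of_not_indep {α : Type*} {M : Matroid α} {p x y : α}
    (hpx : M.Indep {p, x}) (hy : y ∈ M.E) (h : ¬ M.Indep {p, x, y}) : y ∈ M.closure {p, x} := by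
  by_contra hcl
  refine h ?_
  have h' := hpx.insert_indep_iff.2 (Or.inl ⟨hy, hcl⟩)
  rwa [insert_comm, pair_comm y x] at h'

theorem eRk_le_two_of_subset_closure_pair {α : Type*} {M : Matroid α} {X : Set α} {p x : α}
    (h : X ⊆ M.closure {p, x}) : M.eRk X ≤ 2 := by
  refine (M.eRk_mono h).trans ?_
  rw [eRk_closure_eq]
  refine (M.eRk_le_encard _).trans ((encard_insert_le _ _).trans ?_)
  rw [encard_singleton, one_add_one_eq_two]

end Matroid

open Matroid

/-- The span of `v x` and `v y` over 𝔽₂ is {0, `v x`, `v y`, `v x + v y`}, and pairwise independence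
excludes the first three. -/
theorem eq_add_of_linearIndepOn {α W : Type*} [AddCommGroup W] [Module (ZMod 2) W] {v : α → W}
    {x y z : α} (hxy : LinearIndepOn (ZMod 2) v {x, y}) (hxz : LinearIndepOn (ZMod 2) v {x, z})
    (hyz : LinearIndepOn (ZMod 2) v {y, z}) (hne : x ≠ z) (hne' : y ≠ z)
    (h : ¬ LinearIndepOn (ZMod 2) v {x, y, z}) : v z = v x + v y := by
  have hz : z ∉ ({x, y} : Set α) := by simp [hne.symm, hne'.symm]
  have hspan : v z ∈ Submodule.span (ZMod 2) (v '' {x, y}) := by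
    by_contra hcon
    refine h ?_
    have := (linearIndepOn_insert hz).2 ⟨hxy, hcon⟩
    rwa [insert_comm, pair_comm z y] at this
  rw [image_pair, Submodule.mem_span_pair] at hspan
  obtain ⟨a, b, hab⟩ := hspan
  have h0 : v z ≠ 0 := hxz.ne_zero (by simp)
  have hx : v x ≠ v z := fun h ↦ hne (hxz.injOn (by simp) (by simp) h)
  have hy : v y ≠ v z := fun h ↦ hne' (hyz.injOn (by simp) (by simp) h)
  have key : ∀ c : ZMod 2, c = 0 ∨ c = 1 := by decide
  rcases key a with rfl | rfl <;> rcases key b with rfl | rfl <;> simp_all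

/-! ### Connected matroids in which the eight lines are dependent -/

theorem coe_subset_closure_pair {N : Matroid (Fin 8)} (hE : N.E = univ) {L : Finset (Fin 8)}
    (hL : L.card = 3) (hdep : ¬ N.Indep L) {p x : Fin 8} (hp : p ∈ L) (hx : x ∈ L) (hne : p ≠ x)
    (hpx : N.Indep {p, x}) : (L : Set (Fin 8)) ⊆ N.closure {p, x} := by
  intro y hy
  have hsub : ({p, x} : Set (Fin 8)) ⊆ N.closure {p, x} := N.subset_closure _ (by simp [hE])
  by_cases hyp : y = p
  · exact hsub (by simp [hyp])
  by_cases hyx : y = x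
  · exact hsub (by simp [hyx])
  refine mem_closure_pair_of_not_indep hpx (by simp [hE]) ?_
  have hLeq : ({p, x, y} : Finset (Fin 8)) = L := by
    refine Finset.eq_of_subset_of_card_le
      (by simp [Finset.insert_subset_iff, hp, hx, Finset.mem_coe.1 hy]) ?_
    rw [hL, Finset.card_eq_three.2 ⟨p, x, y, hne, Ne.symm hyp, Ne.symm hyx, rfl⟩]
  rw [← hLeq] at hdep
  simpa using hdep

section Connected

variable {N : Matroid (Fin 8)}

/-- A line is added only if it has a point `p` of `U` in `P` and a point `x` of `U` outside `P`. By
`hP` these are independent, so they span the line. -/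
theorem lineStep_subset_closure (hE : N.E = univ) (hL : ∀ L ∈ eightLines, ¬ N.Indep L)
    {P U ℓ : ℕ} {X : Set (Fin 8)}
    (hP : ∀ p x : Fin 8, P.testBit p → ¬ P.testBit x → N.Indep {p, x}) (hℓ : ℓ ∈ lineMasks)
    (hU : ∀ i : Fin 8, U.testBit i → i ∈ N.closure X) :
    ∀ i : Fin 8, (lineStep P U ℓ).testBit i → i ∈ N.closure X := by
  intro y hy
  rw [lineStep] at hy
  cases hc : ((ℓ &&& U &&& P).beq 0 || ((ℓ &&& U) ||| P).beq P) with
  | true => exact hU y (by simpa [hc] using hy)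
  | false =>
    rw [hc, cond_false, Nat.testBit_or, Bool.or_eq_true] at hy
    refine hy.elim (hU y) fun hyℓ ↦ ?_
    obtain ⟨hlt, L, hLm, hLℓ⟩ := exists_line_of_mem_lineMasks ℓ hℓ
    have lt_of_bit {i : ℕ} (hi : ℓ.testBit i) : i < 8 := by
      by_contra! hge
      rw [Nat.testBit_lt_two_pow (hlt.trans_le (Nat.pow_le_pow_right two_pos hge))] at hi
      exact Bool.false_ne_true hi
    rw [Bool.or_eq_false_iff] at hc
    obtain ⟨p, hp⟩ := Nat.exists_testBit_of_ne_zero (Nat.ne_of_beq_eq_false hc.1)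
    simp only [Nat.testBit_and, Bool.and_eq_true] at hp
    obtain ⟨x, hx⟩ := Nat.exists_testBit_ne_of_ne (Nat.ne_of_beq_eq_false hc.2)
    have hx' : (ℓ.testBit x ∧ U.testBit x) ∧ ¬ P.testBit x := by
      rw [Nat.testBit_or, Nat.testBit_and] at hx
      revert hx
      cases ℓ.testBit x <;> cases U.testBit x <;> cases P.testBit x <;> decide
    lift p to Fin 8 using lt_of_bit hp.1.1
    lift x to Fin 8 using lt_of_bit hx'.1.1
    refine N.closure_subset_closure_of_subset_closure ?_
      (coe_subset_closure_pair hE (card_of_mem_eightLines L hLm) (hL L hLm) ((hLℓ p).2 hp.1.1)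
        ((hLℓ x).2 hx'.1.1) (by rintro rfl; exact hx'.2 hp.2) (hP p x hp.2 hx'.2)
        ((hLℓ y).2 hyℓ))
    exact pair_subset (hU p hp.1.2) (hU x hx'.1.2)

theorem lineSweep_subset_closure (hE : N.E = univ) (hL : ∀ L ∈ eightLines, ¬ N.Indep L)
    {X : Set (Fin 8)} {Ps : List ℕ}
    (hPs : ∀ P ∈ Ps, ∀ p x : Fin 8, P.testBit p → ¬ P.testBit x → N.Indep {p, x}) {T : ℕ}
    (hT : ∀ i : Fin 8, T.testBit i → i ∈ N.closure X) :
    ∀ i : Fin 8, (lineSweep Ps T).testBit i → i ∈ N.closure X := by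
  refine List.foldlRecOn (motive := fun U : ℕ ↦ ∀ i : Fin 8, U.testBit i → i ∈ N.closure X) Ps _ hT
    fun U hU P hP ↦ ?_
  exact List.foldlRecOn (motive := fun U : ℕ ↦ ∀ i : Fin 8, U.testBit i → i ∈ N.closure X) _ _ hU
    fun V hV ℓ hℓ ↦ lineStep_subset_closure hE hL (hPs P hP) hℓ hV

theorem isNonloop_of_connected (hE : N.E = univ) (hr : N.eRank = 3)
    (hN : N.IsConnectedMatroid) (x : Fin 8) : N.IsNonloop x := by
  by_contra h
  have h1 : N.eRk {x} = 0 := ((not_isNonloop_iff (by simp [hE])).1 h).eRk_eq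
  obtain ⟨y, hy⟩ := exists_ne x
  have hlt := eRk_add_eRk_compl_gt hN (X := {x}) (by simp [hE]) (by simp) ⟨y, by simp [hE, hy]⟩
    (by simp [hr])
  rw [h1, zero_add] at hlt
  exact hlt.not_ge (N.eRk_le_eRank _)

theorem indep_pair_of_connected (hE : N.E = univ) (hr : N.eRank = 3)
    (hL : ∀ L ∈ eightLines, ¬ N.Indep L) (hN : N.IsConnectedMatroid) (e f : Fin 8) :
    N.Indep {e, f} := by
  classical
  have hloop := isNonloop_of_connected hE hr hN
  by_contra hdep
  have hef : e ≠ f := by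
    rintro rfl
    exact hdep (by simpa using (hloop e).indep)
  have hfe : f ∈ N.closure {e} := by
    by_contra hcon
    refine hdep ?_
    rw [pair_comm]
    exact (hloop e).indep.insert_indep_iff.2 (Or.inl ⟨by simp [hE], hcon⟩)
  -- The mask of the parallel class of `e`; it also contains `f`, so it is not a single point.
  set P : ℕ := Nat.ofBits fun i : Fin 8 ↦ decide (i ∈ N.closure {e}) with hPdef
  have hP : ∀ y : Fin 8, P.testBit y ↔ y ∈ N.closure {e} := fun y ↦ by
    rw [hPdef, Nat.testBit_ofBits_lt _ _ y.2, decide_eq_true_iff]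
  have hee : e ∈ N.closure {e} := N.mem_closure_self e (by simp [hE])
  have hP0 : P ≠ 0 := by
    intro h
    simpa [h] using (hP e).2 hee
  have hP2 : ∀ i : Fin 8, P ≠ 2 ^ i.val := by
    intro i h
    have he := (hP e).2 hee
    have hf := (hP f).2 hfe
    rw [h, Nat.testBit_two_pow, decide_eq_true_iff] at he hf
    exact hef (Fin.ext (he.symm.trans hf))
  obtain hline | ⟨d, v, hdv⟩ := exists_lineSweep_eq P (Nat.ofBits_lt_two_pow _) hP0 hP2
  · obtain ⟨-, L, hLm, hLP⟩ := exists_line_of_mem_lineMasks _ hline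
    have hLE : N.E \ N.closure {e} = L := by
      ext i
      rw [Finset.mem_coe, hLP, Nat.testBit_xor, testBit_255, Bool.true_xor, hE, mem_sdiff, ← hP]
      simp
    have hc := card_of_mem_eightLines _ hLm
    have hrk2 : N.eRk (N.E \ N.closure {e}) ≤ 2 := by
      have h3 := eRk_lt_encard_of_dep_of_finite (M := N) (Finset.finite_toSet _)
        ⟨hL _ hLm, by simp [hE]⟩
      rw [encard_coe_eq_coe_finsetCard, hc] at h3
      rw [hLE]
      exact Order.le_of_lt_add_one h3
    have hrk1 : N.eRk (N.closure {e}) ≤ 1 := by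
      rw [eRk_closure_eq]
      exact N.eRk_singleton_le e
    have hne : (N.E \ N.closure {e}).Nonempty := by
      rw [hLE, Finset.coe_nonempty, ← Finset.card_pos]
      omega
    have hlt := eRk_add_eRk_compl_gt hN (N.closure_subset_ground _) ⟨e, hee⟩ hne (by simp [hr])
    rw [hr] at hlt
    exact hlt.not_ge ((add_le_add hrk1 hrk2).trans (by norm_num))
  · have hPind : ∀ p x : Fin 8, P.testBit p → ¬ P.testBit x → N.Indep {p, x} := by
      intro p x hp hx
      rw [pair_comm]
      refine (hloop p).indep.insert_indep_iff.2 (Or.inl ⟨by simp [hE], ?_⟩)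
      rw [(hloop p).closure_eq_of_mem_closure ((hP p).1 hp)]
      exact fun h ↦ hx ((hP x).2 h)
    have hsub := lineSweep_subset_closure hE hL (X := {e, d}) (Ps := [P, P])
      (by simpa using hPind) (T := P ||| 2 ^ d.val) (by
        intro i hi
        rw [Nat.testBit_or, Bool.or_eq_true, Nat.testBit_two_pow, decide_eq_true_iff] at hi
        refine hi.elim (fun h ↦ N.closure_subset_closure (by simp) ((hP i).1 h)) fun h ↦ ?_
        exact N.mem_closure_of_mem (by simp [Fin.ext h]) (by simp [hE]))
    have hsub' : N.E \ {v} ⊆ N.closure {e, d} := by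
      intro y hy
      have h := testBit_255 y
      rw [← hdv, Nat.testBit_or, Bool.or_eq_true, Nat.testBit_two_pow, decide_eq_true_iff] at h
      exact h.elim (hsub y) fun h ↦ absurd (Fin.ext h).symm hy.2
    obtain ⟨y, hy⟩ := exists_ne v
    have hlt := eRk_add_eRk_compl_gt hN (X := {v}) (by simp [hE]) (by simp) ⟨y, by simp [hE, hy]⟩
      (by simp [hr])
    rw [hr] at hlt
    exact hlt.not_ge ((add_le_add (N.eRk_singleton_le v)
      (eRk_le_two_of_subset_closure_pair hsub')).trans (by norm_num))

theorem indep_of_isNonline_of_connected (hE : N.E = univ) (hr : N.eRank = 3)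
    (hL : ∀ L ∈ eightLines, ¬ N.Indep L) (hN : N.IsConnectedMatroid) {S : Finset (Fin 8)}
    (hS : IsNonline S) : N.Indep S := by
  have hpair := indep_pair_of_connected hE hr hL hN
  by_contra hdep
  obtain ⟨x, y, z, hxy, -, -, rfl⟩ := Finset.card_eq_three.1 hS.1
  have hline := coe_subset_closure_pair hE hS.1 hdep (by simp) (by simp) hxy (hpair x y)
  -- All pairs are independent now, so `P` may run through the single points: any two known points
  -- of a line yield the line.
  have hsweep := lineSweep_subset_closure hE hL (X := {x, y}) (Ps := pointMasks ++ pointMasks)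
    (fun _ _ p q _ _ ↦ hpair p q) (T := 2 ^ x.val ||| 2 ^ y.val ||| 2 ^ z.val) (by
      intro i hi
      simp only [Nat.testBit_or, Bool.or_eq_true, Nat.testBit_two_pow, decide_eq_true_iff,
        Fin.val_inj] at hi
      refine hline ?_
      simp only [Finset.coe_insert, Finset.coe_singleton, mem_insert_iff, mem_singleton_iff]
      tauto)
  rw [lineSweep_points_eq x y z hS] at hsweep
  have hsub : N.E ⊆ N.closure {x, y} := fun i _ ↦ hsweep i (testBit_255 i)
  have := eRk_le_two_of_subset_closure_pair hsub
  rw [eRk_ground, hr] at this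
  exact absurd this (by norm_num)

end Connected

/-! ### The matroid of the eight lines and its properties -/

theorem isNonline_iff {S : Finset (Fin 8)} :
    IsNonline S ↔ S.card = 3 ∧ ∀ L ∈ eightLines, (S ∩ L).card ≤ 2 := by
  refine and_congr_right fun hS ↦ ⟨fun h L hL ↦ ?_, fun h hS' ↦ ?_⟩
  · by_contra! hlt
    refine h ?_
    have h1 := Finset.eq_of_subset_of_card_le (Finset.inter_subset_left (s₁ := S) (s₂ := L))
      (by omega)
    have h2 := Finset.eq_of_subset_of_card_le (Finset.inter_subset_right (s₁ := S) (s₂ := L))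
      (by have := card_of_mem_eightLines L hL; omega)
    rwa [← h1, h2]
  · have := h S hS'
    rw [Finset.inter_self] at this
    omega

theorem isNonline_exchange {S T : Finset (Fin 8)} (hS : IsNonline S) (hT : IsNonline T)
    {a : Fin 8} (haS : a ∈ S) (haT : a ∉ T) :
    ∃ b ∈ T, b ∉ S ∧ IsNonline (insert b (S.erase a)) := by
  obtain ⟨u, v, huv, hSa⟩ : ∃ u v, u ≠ v ∧ S.erase a = {u, v} := by
    rw [← Finset.card_eq_two, Finset.card_erase_of_mem haS, hS.1]
  obtain ⟨b, hbT, hb⟩ := exists_extension_isNonline huv hT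
  rw [← hSa] at hb
  refine ⟨b, hbT, fun hbS ↦ ?_, hb⟩
  have hba : b ∈ S.erase a := Finset.mem_erase.2 ⟨by rintro rfl; exact haT hbT, hbS⟩
  have hc := hb.1
  rw [Finset.insert_eq_of_mem hba, Finset.card_erase_of_mem haS, hS.1] at hc
  omega

/-- The matroid whose bases are the three-element sets other than the eight lines. -/
def eightLinesMatroid : Matroid (Fin 8) :=
  Matroid.ofIsBaseOfFinite (E := univ) finite_univ
    (fun B ↦ ∃ S : Finset (Fin 8), IsNonline S ∧ (S : Set (Fin 8)) = B)
    ⟨_, {0, 1, 2}, by decide +kernel, rfl⟩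
    (by
      rintro _ _ ⟨S, hS, rfl⟩ ⟨T, hT, rfl⟩ a ⟨haS, haT⟩
      obtain ⟨b, hbT, hbS, hb⟩ := isNonline_exchange hS hT haS haT
      exact ⟨b, ⟨hbT, hbS⟩, _, hb, by simp⟩)
    (fun _ _ ↦ subset_univ _)

namespace eightLinesMatroid

theorem ground_eq : eightLinesMatroid.E = univ := rfl

theorem isBase_iff {B : Set (Fin 8)} :
    eightLinesMatroid.IsBase B ↔ ∃ S : Finset (Fin 8), IsNonline S ∧ (S : Set (Fin 8)) = B :=
  Iff.rfl

theorem isBase_coe_iff {S : Finset (Fin 8)} : eightLinesMatroid.IsBase S ↔ IsNonline S := by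
  simp [isBase_iff]

theorem isBase_iff_ncard {B : Set (Fin 8)} :
    eightLinesMatroid.IsBase B ↔
      B.ncard = 3 ∧ ∀ L ∈ eightLines, (B ∩ (L : Set (Fin 8))).ncard ≤ 2 := by
  obtain ⟨S, rfl⟩ := (toFinite B).exists_finset_coe
  rw [isBase_coe_iff, isNonline_iff, ncard_coe_finset]
  simp only [← Finset.coe_inter, ncard_coe_finset]

theorem eRank_eq : eightLinesMatroid.eRank = 3 := by
  have h : eightLinesMatroid.IsBase ({0, 1, 2} : Finset (Fin 8)) :=
    isBase_coe_iff.2 (by decide +kernel)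
  rw [← h.encard_eq_eRank, encard_coe_eq_coe_finsetCard]
  rfl

theorem indep_coe_iff {S : Finset (Fin 8)} (hS : S.card = 3) :
    eightLinesMatroid.Indep S ↔ S ∉ eightLines := by
  refine ⟨fun h ↦ ?_, fun h ↦ (isBase_coe_iff.2 ⟨hS, h⟩).indep⟩
  refine (isBase_coe_iff.1 (h.isBase_of_eRk_ge (Finset.finite_toSet S) ?_)).2
  rw [h.eRk_eq_encard, eRank_eq, encard_coe_eq_coe_finsetCard, hS]
  rfl

theorem not_indep {L : Finset (Fin 8)} (hL : L ∈ eightLines) : ¬ eightLinesMatroid.Indep L := by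
  rw [indep_coe_iff (card_of_mem_eightLines L hL)]
  exact not_not_intro hL

theorem indep_pair (x y : Fin 8) : eightLinesMatroid.Indep {x, y} := by
  obtain ⟨w, z, h, hy⟩ := exists_isNonline_mem x y
  refine (isBase_coe_iff.2 h).indep.subset ?_
  exact pair_subset (by simp) hy

theorem isSimpleMatroid : eightLinesMatroid.IsSimpleMatroid := fun x _ y _ ↦ indep_pair x y

theorem eRk_line {L : Finset (Fin 8)} (hL : L ∈ eightLines) : eightLinesMatroid.eRk L = 2 := by
  have hc := card_of_mem_eightLines L hL
  apply le_antisymm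
  · have h := eRk_lt_encard_of_dep_of_finite (M := eightLinesMatroid) (Finset.finite_toSet L)
      ⟨not_indep hL, subset_univ _⟩
    rw [encard_coe_eq_coe_finsetCard, hc] at h
    exact Order.le_of_lt_add_one h
  · obtain ⟨x, y, z, hxy, -, -, rfl⟩ := Finset.card_eq_three.1 hc
    rw [← encard_pair hxy, ← (indep_pair x y).eRk_eq_encard]
    exact eightLinesMatroid.eRk_mono (pair_subset (by simp) (by simp))

theorem eRk_eq_three_of_isNonline {S : Finset (Fin 8)} (hS : IsNonline S) :
    eightLinesMatroid.eRk S = 3 := by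
  rw [(isBase_coe_iff.2 hS).eRk_eq_eRank, eRank_eq]

theorem eRk_insert_line {L : Finset (Fin 8)} (hL : L ∈ eightLines) {w : Fin 8} (hw : w ∉ L) :
    3 ≤ eightLinesMatroid.eRk (insert w (L : Set (Fin 8))) := by
  obtain ⟨x, -, hx⟩ := exists_isNonline_subset_insert L hL w hw
  rw [← eRk_eq_three_of_isNonline hx, Finset.coe_insert]
  exact eightLinesMatroid.eRk_mono (insert_subset_insert (Finset.coe_subset.2 (L.erase_subset x)))

theorem isFlat_line {L : Finset (Fin 8)} (hL : L ∈ eightLines) : eightLinesMatroid.IsFlat L := by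
  refine isFlat_iff_closure_eq.2
    ((eightLinesMatroid.subset_closure _ (subset_univ _)).antisymm' fun w hw ↦ ?_)
  by_contra hwL
  have h : eightLinesMatroid.eRk (insert w (L : Set (Fin 8))) ≤
      eightLinesMatroid.eRk (eightLinesMatroid.closure L) :=
    eightLinesMatroid.eRk_mono
      (insert_subset hw (eightLinesMatroid.subset_closure _ (subset_univ _)))
  rw [eRk_closure_eq, eRk_line hL] at h
  exact absurd ((eRk_insert_line hL hwL).trans h) (by norm_num)

theorem isFlat_and_iff {F : Set (Fin 8)} :
    eightLinesMatroid.IsFlat F ∧ eightLinesMatroid.eRk F = 2 ∧ 3 ≤ F.ncard ↔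
      ∃ L ∈ eightLines, F = (L : Set (Fin 8)) := by
  constructor
  · rintro ⟨-, hrk, hcard⟩
    obtain ⟨S, rfl⟩ := (toFinite F).exists_finset_coe
    rw [ncard_coe_finset] at hcard
    obtain ⟨L, hLS, hLc⟩ := Finset.exists_subset_card_eq hcard
    have hL : L ∈ eightLines := by
      by_contra hL
      have h := eightLinesMatroid.eRk_mono (Finset.coe_subset.2 hLS)
      rw [eRk_eq_three_of_isNonline ⟨hLc, hL⟩, hrk] at h
      exact absurd h (by norm_num)
    refine ⟨L, hL, congrArg _ (Finset.Subset.antisymm (fun w hw ↦ ?_) hLS)⟩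
    by_contra hwL
    have h := eightLinesMatroid.eRk_mono
      (insert_subset (Finset.mem_coe.2 hw) (Finset.coe_subset.2 hLS))
    rw [hrk] at h
    exact absurd ((eRk_insert_line hL hwL).trans h) (by norm_num)
  · rintro ⟨L, hL, rfl⟩
    exact ⟨isFlat_line hL, eRk_line hL, by rw [ncard_coe_finset, card_of_mem_eightLines L hL]⟩

theorem isConnectedMatroid : eightLinesMatroid.IsConnectedMatroid := by
  rintro ⟨M₁, M₂, hd, ⟨x, hx⟩, ⟨y, hy⟩, h⟩
  obtain ⟨w, z, hxS, hyS⟩ := exists_common_isNonline x y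
  have hbx := isBase_coe_iff.2 hxS
  have hby := isBase_coe_iff.2 hyS
  rw [h, disjointSum_isBase_iff] at hbx hby
  have hy₁ : y ∉ M₁.E := fun h ↦ hd.notMem_of_mem_left h hy
  -- The two bases differ only in `x` and `y`; as `y` is outside `M₁.E`, the trace of one on `M₁`
  -- lies in that of the other, so these bases of `M₁` agree.
  have heq := hby.1.eq_of_subset_isBase hbx.1 (by
    rintro t ⟨ht, ht₁⟩
    refine ⟨?_, ht₁⟩
    simp only [Finset.coe_insert, mem_insert_iff] at ht ⊢
    exact ht.elim (fun h ↦ absurd (h ▸ ht₁) hy₁) Or.inr)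
  have hxy : x ∈ ((({y, w, z} : Finset (Fin 8)) : Set (Fin 8)) ∩ M₁.E) := by
    rw [heq]
    exact ⟨by simp, hx⟩
  have hxwz : x ∈ ({w, z} : Finset (Fin 8)) :=
    (Finset.mem_insert.1 hxy.1).resolve_left (by rintro rfl; exact hy₁ hx)
  have hc := hxS.1
  rw [Finset.insert_eq_of_mem hxwz] at hc
  have := Finset.card_le_two (a := w) (b := z)
  omega

theorem not_isBinary : ¬ eightLinesMatroid.IsBinary := by
  rintro ⟨W, _, _, v, hv⟩
  have hp (x y : Fin 8) : LinearIndepOn (ZMod 2) v {x, y} :=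
    (hv _ (subset_univ _)).1 (indep_pair x y)
  have hline (x y z : Fin 8) (hL : {x, y, z} ∈ eightLines) (hne : x ≠ z) (hne' : y ≠ z) :
      v z = v x + v y := by
    refine eq_add_of_linearIndepOn (hp x y) (hp x z) (hp y z) hne hne' fun h ↦ not_indep hL ?_
    refine (hv _ (subset_univ _)).2 ?_
    simpa using h
  have h7 : v 7 = v 0 + v 2 := hline 0 2 7 (by decide) (by decide) (by decide)
  have h3 : v 3 = v 1 + v 2 := hline 1 2 3 (by decide) (by decide) (by decide)
  have h5 : v 5 = v 0 + v 3 := hline 0 3 5 (by decide) (by decide) (by decide)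
  have h4 : v 4 = v 1 + v 7 := hline 1 7 4 (by decide) (by decide) (by decide)
  -- Both vectors equal `v 0 + v 1 + v 2`.
  have h45 : v 4 = v 5 := by rw [h4, h5, h7, h3]; abel
  exact absurd ((hp 4 5).injOn (by simp) (by simp) h45) (by decide)

theorem isMinimalConnected : eightLinesMatroid.IsMinimalConnected := by
  refine ⟨isConnectedMatroid, fun N hN ⟨hE, hsub⟩ ↦ ?_⟩
  have hB {B : Set (Fin 8)} (h : N.IsBase B) : eightLinesMatroid.IsBase B := hsub h
  obtain ⟨B₀, hB₀⟩ := N.exists_isBase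
  have hr : N.eRank = 3 := by
    rw [← hB₀.encard_eq_eRank, (hB hB₀).encard_eq_eRank, eRank_eq]
  have hL : ∀ L ∈ eightLines, ¬ N.Indep L := fun L hL hI ↦ by
    obtain ⟨B, hNB, hLB⟩ := hI.exists_isBase_superset
    exact not_indep hL ((hB hNB).indep.subset hLB)
  refine ext_isBase hE fun B _ ↦ ⟨fun h ↦ hB h, ?_⟩
  rintro ⟨S, hS, rfl⟩
  have hI := indep_of_isNonline_of_connected (hE.trans ground_eq) hr hL hN hS
  obtain ⟨B, hNB, hSB⟩ := hI.exists_isBase_superset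
  rwa [(isBase_coe_iff.2 hS).eq_of_subset_isBase (hB hNB) hSB]

end eightLinesMatroid

open eightLinesMatroid

theorem theorem4p3 :
    (eightLines.card = 8 ∧ ∀ L ∈ eightLines, L.card = 3) ∧
    ∃ M : Matroid (Fin 8),
      M.E = Set.univ ∧
      (∀ B : Set (Fin 8), M.IsBase B ↔
        B.ncard = 3 ∧ ∀ L ∈ eightLines, (B ∩ (L : Set (Fin 8))).ncard ≤ 2) ∧
      M.eRank = 3 ∧
      {F : Set (Fin 8) | M.IsFlat F ∧ M.eRk F = 2 ∧ 3 ≤ F.ncard} =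
        {F : Set (Fin 8) | ∃ L ∈ eightLines, F = (L : Set (Fin 8))} ∧
      M.IsSimpleMatroid ∧
      M.IsConnectedMatroid ∧
      M.IsTypeB := by
  refine ⟨⟨by decide, card_of_mem_eightLines⟩, eightLinesMatroid, ground_eq,
    fun _ ↦ isBase_iff_ncard, eRank_eq, ?_, isSimpleMatroid, isConnectedMatroid, not_isBinary,
    isMinimalConnected⟩
  ext F
  exact isFlat_and_iff
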